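/- Throughout, $H_1$ denotes singular homology with integer coefficients and $T^n=(S^1)^n$ is the standard $n$-torus. For a topological space $X$, let $\mathrm{cat}(X)\in\{0,1,2,\dots,\infty\}$ be the (reduced) Lusternik--Schnirelmann category: the least $k$ such that $X$ is covered by $k+1$ open sets whose inclusions into $X$ are null-homotopic, and $\infty$ if there is no such $k$. For $r>1$, let $\mathrm{TC}_r(X)\in\{0,1,2,\dots,\infty\}$ be the (reduced) $r$-th sequential topological complexity: the least $k$ such that $X^r$ is covered by $k+1$ open sets, each of which admits a continuous section of the evaluation map $X^{[0,1]}\to X^r$, $\gamma\mapsto\bigl(\gamma(0),\gamma(\tfrac1{r-1}),\dots,\gamma(1)\bigr)$, and $\infty$ if there is no such $k$. **Proposition 2.2.** Let $X$ be a topological space and $n\ge 0$ an integer. 1. If there is a continuous map $f:T^n\to X$ such that $f_*:H_1(T^n)\to H_1(X)$ is injective, then $\mathrm{cat}(X)\ge n$. 2. If there are continuous maps $f,g:T^n\to X$ such that $f_*,g_*:H_1(T^n)\to H_1(X)$ are both injective and $\mathrm{im}(f_*)\cap\mathrm{im}(g_*)=0$, then $\mathrm{TC}_r(X)\ge rn$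 for every integer $r>1$. -/

import Mathlib

open CategoryTheory unitInterval

universe u

namespace DecomposableTori

/-- First singular homology with integer coefficients, as a functor on topological spaces. -/
noncomputable def singularH1 : TopCat.{u} ⥤ ModuleCat.{u} ℤ :=
  (AlgebraicTopology.singularHomologyFunctor (ModuleCat.{u} ℤ) 1).obj
    (ModuleCat.of ℤ (ULift.{u} ℤ))

/-- The standard `n`-torus `(S¹)ⁿ`. -/
abbrev Torus (n : ℕ) : Type := Fin n → Circle

section Homology

variable {X : Type u} [TopologicalSpace X] {n : ℕ}

/-- The homomorphism `f_* : H₁(Tⁿ; ℤ) → H₁(X; ℤ)` induced by an `n`-torus `f : Tⁿ → X`.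
The torus is lifted to the universe of `X`. -/
noncomputable def torusH1 (f : C(Torus n, X)) :
    singularH1.obj (TopCat.of (ULift.{u} (Torus n))) →ₗ[ℤ] singularH1.obj (TopCat.of X) :=
  (singularH1.map (TopCat.ofHom
    (f.comp (⟨ULift.down, continuous_uliftDown⟩ : C(ULift.{u} (Torus n), Torus n))))).hom

/-- An `n`-torus is homologically decomposable if it is injective on `H₁`. -/
def HomologicallyDecomposable (f : C(Torus n, X)) : Prop :=
  Function.Injective (torusH1 f)

/-- Two `n`-tori are homologically disjoint if the images of `H₁` intersect trivially. -/
def HomologicallyDisjoint (f g : C(Torus n, X)) : Prop :=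
  LinearMap.range (torusH1 f) ⊓ LinearMap.range (torusH1 g) = ⊥

end Homology

section Invariants

variable (X : Type u) [TopologicalSpace X]

/-- `X` is covered by `k + 1` open sets, each of which is contractible in `X`. -/
def HasCategoricalCover (k : ℕ) : Prop :=
  ∃ U : Fin (k + 1) → Set X,
    (∀ i, IsOpen (U i)) ∧ (⋃ i, U i) = Set.univ ∧
    ∀ i, (⟨Subtype.val, continuous_subtype_val⟩ : C(U i, X)).Nullhomotopic

/-- The reduced Lusternik-Schnirelmann category: the least `k` such that `X` has a categorical
open cover by `k + 1` sets, and `⊤` if there is none. -/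
noncomputable def lsCat : ℕ∞ :=
  ⨅ (k : ℕ) (_ : HasCategoricalCover X k), (k : ℕ∞)

/-- The time `i / (r - 1)` in `[0, 1]`, for `0 ≤ i < r`. -/
noncomputable def evalTime (r : ℕ) (i : Fin r) : I :=
  ⟨(i : ℝ) / ((r : ℝ) - 1), by
    have h : (i : ℝ) + 1 ≤ (r : ℝ) := by exact_mod_cast i.isLt
    have h0 : (0 : ℝ) ≤ (i : ℝ) := Nat.cast_nonneg _
    exact ⟨div_nonneg h0 (by linarith), div_le_one_of_le₀ (by linarith) (by linarith)⟩⟩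

variable {X} in
/-- The map `X^I → X^r`, `γ ↦ (γ(0), γ(1/(r-1)), …, γ(1))`. -/
noncomputable def pathEval (r : ℕ) (γ : C(I, X)) : Fin r → X :=
  fun i => γ (evalTime r i)

/-- `X^r` is covered by `k + 1` open sets, each of which carries a continuous section of
`pathEval r` (the path space has the compact-open topology). -/
def HasMotionPlannerCover (r k : ℕ) : Prop :=
  ∃ U : Fin (k + 1) → Set (Fin r → X),
    (∀ i, IsOpen (U i)) ∧ (⋃ i, U i) = Set.univ ∧
    ∀ i, ∃ s : C(U i, C(I, X)), ∀ p : U i, pathEval r (s p) = p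

/-- The reduced `r`-th sequential topological complexity, for `r ≥ 2`: the least `k` such that
`X^r` has an open cover by `k + 1` sets with local sections, and `⊤` if there is none. -/
noncomputable def sequentialTC (r : ℕ) : ℕ∞ :=
  ⨅ (k : ℕ) (_ : HasMotionPlannerCover X r k), (k : ℕ∞)

end Invariants

end DecomposableTori

/-! Classically, the `m` angle classes of `Tᵐ` have nonzero cup product. If the `k`-th class
vanished on `V k` for an open cover `V` by `m` sets, it would lift to a relative class, and the
product would lie in the zero group `Hᵐ(Tᵐ, ⋃ V k)`. Hence no cover by `m` or fewer open sets kills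
every coordinate on `H₁` (`not_cover_of_coordOn_eq_zero`). The cup product is computed on a fine
grid in `Tᵐ`, whose monotone lattice paths form a fundamental cycle (`cupSum_linearCochain_sub`,
`not_exists_angle_primitive`). `exists_angle_primitive` turns triviality on singular `H₁` into a
primitive of the angle. For `cat`, a categorical cover of `X` is pulled back along `f`; injectivity
of `f_*` makes the coordinates trivial on each set. For `TC_r`, the cover of `Xʳ` is pulled back
along `f × g × ⋯ × g` on `T^{rn}`. A motion planner makes the factors homotopic, so their images on
`H₁` lie in `im f_* ∩ im g_* = 0`. -/

namespace DecomposableTori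

/-! ### Discrete cup products on a finite grid -/

section Grid

variable {G : Type*} [AddCommGroup G] {m : ℕ} (e : Fin m → G)

/-- The `k`-th vertex of the monotone lattice path from `x` taking the steps `e (τ 0)`,
`e (τ 1)`, …. -/
def pathVertex (τ : Equiv.Perm (Fin m)) (x : G) (k : Fin m) : G :=
  x + ∑ i ∈ Finset.Iio k, e (τ i)

/-- The cup product of `m` one-cochains on the Cayley grid of `G`, evaluated on the fundamental
cycle formed by the monotone lattice paths. -/
def cupSum [Fintype G] (u : Fin m → G → Fin m → ℝ) : ℝ :=
  ∑ x, ∑ τ : Equiv.Perm (Fin m), ((τ.sign : ℤ) : ℝ) * ∏ k, u k (pathVertex e τ x k) (τ k)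

/-- One-cochains on the grid that are closed: they sum to zero around each square. -/
def IsGridCocycle (u : G → Fin m → ℝ) : Prop :=
  ∀ x i j, u x i + u (x + e i) j = u x j + u (x + e j) i

/-- The coboundary of a function on the grid. -/
def gridDiff (c : G → ℝ) (x : G) (i : Fin m) : ℝ := c (x + e i) - c x

variable {e}

lemma sum_sign_mul_eq_zero_of_swap {j p : Fin m} (hjp : p ≠ j) {D : Equiv.Perm (Fin m) → ℝ}
    (hD : ∀ τ, D (τ * Equiv.swap j p) = D τ) :
    ∑ τ : Equiv.Perm (Fin m), ((τ.sign : ℤ) : ℝ) * D τ = 0 := by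
  have h := Equiv.sum_comp (Equiv.mulRight (Equiv.swap j p))
    (fun τ : Equiv.Perm (Fin m) => ((τ.sign : ℤ) : ℝ) * D τ)
  simp only [Equiv.coe_mulRight, hD, Equiv.Perm.sign_mul, Equiv.Perm.sign_swap hjp.symm] at h
  simp only [mul_neg, mul_one, Units.val_neg, Int.cast_neg, neg_mul, Finset.sum_neg_distrib] at h
  linarith

/-- The factors of the product where the `j`-th cochain is replaced by the function `c`, and the
step `e (τ j)` is taken before the `p`-th vertex. -/
noncomputable def shiftedFactor (e : Fin m → G) (u : Fin m → G → Fin m → ℝ) (c : G → ℝ)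
    (j : Fin m) (p : ℕ) (x : G) (τ : Equiv.Perm (Fin m)) (k : Fin m) : ℝ :=
  let y := x + ∑ i ∈ (Finset.Iio k).erase j, e (τ i) + if p ≤ k then e (τ j) else 0
  if k = j then c y else u k y (τ k)

lemma shiftedFactor_succ_of_ne (u : Fin m → G → Fin m → ℝ) (c : G → ℝ) (j : Fin m)
    {p k : Fin m} (hk : k ≠ p) (x : G) (τ : Equiv.Perm (Fin m)) :
    shiftedFactor e u c j (p + 1) x τ k = shiftedFactor e u c j p x τ k := by
  have : ((p : ℕ) + 1 ≤ k) ↔ (p : ℕ) ≤ k := by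
    have := Fin.val_ne_of_ne hk
    omega
  simp only [shiftedFactor, this]

lemma prod_shiftedFactor_sub (u : Fin m → G → Fin m → ℝ) (c : G → ℝ) (j p : Fin m)
    (x : G) (τ : Equiv.Perm (Fin m)) :
    ∏ k, shiftedFactor e u c j p x τ k - ∏ k, shiftedFactor e u c j (p + 1) x τ k =
      (shiftedFactor e u c j p x τ p - shiftedFactor e u c j (p + 1) x τ p) *
        ∏ k ∈ Finset.univ.erase p, shiftedFactor e u c j p x τ k := by
  rw [← Finset.mul_prod_erase _ _ (Finset.mem_univ p),
    ← Finset.mul_prod_erase Finset.univ (shiftedFactor e u c j (p + 1) x τ) (Finset.mem_univ p),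
    Finset.prod_congr rfl fun k hk =>
      shiftedFactor_succ_of_ne u c j (Finset.ne_of_mem_erase hk) x τ]
  ring

/-- The `k`-th vertex lies either past both steps `e (τ j)` and `e (τ p)` or before both, so
exchanging them does not move it. -/
lemma shiftedFactor_swap {u : Fin m → G → Fin m → ℝ} (c : G → ℝ) {j p k : Fin m} (hp : p ≠ j)
    (hk : k ≠ p) (x : G) (τ : Equiv.Perm (Fin m)) :
    shiftedFactor e u c j p x (τ * Equiv.swap j p) k = shiftedFactor e u c j p x τ k := by
  have key : x + ∑ i ∈ (Finset.Iio k).erase j, e ((τ * Equiv.swap j p) i) +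
        (if (p : ℕ) ≤ k then e ((τ * Equiv.swap j p) j) else 0) =
      x + ∑ i ∈ (Finset.Iio k).erase j, e (τ i) + (if (p : ℕ) ≤ k then e (τ j) else 0) := by
    have hrest : ∀ i, i ≠ j → i ≠ p → (τ * Equiv.swap j p) i = τ i := fun i h₁ h₂ => by
      simp [Equiv.swap_apply_of_ne_of_ne h₁ h₂]
    by_cases h : (p : ℕ) ≤ k
    · have hpk : p ∈ (Finset.Iio k).erase j := by
        simp only [Finset.mem_erase, Finset.mem_Iio]
        exact ⟨hp, lt_of_le_of_ne h hk.symm⟩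
      rw [← Finset.add_sum_erase _ _ hpk, ← Finset.add_sum_erase _ (fun i => e (τ i)) hpk,
        Finset.sum_congr rfl fun i hi => by
          rw [hrest i (Finset.ne_of_mem_erase (Finset.mem_of_mem_erase hi))
            (Finset.ne_of_mem_erase hi)]]
      simp only [h, if_true, Equiv.Perm.mul_apply, Equiv.swap_apply_left, Equiv.swap_apply_right]
      abel
    · have hsum : ∑ i ∈ (Finset.Iio k).erase j, e ((τ * Equiv.swap j p) i) =
          ∑ i ∈ (Finset.Iio k).erase j, e (τ i) := by
        refine Finset.sum_congr rfl fun i hi => ?_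
        rw [hrest i (Finset.ne_of_mem_erase hi)]
        rintro rfl
        have : i < k := Finset.mem_Iio.1 (Finset.mem_of_mem_erase hi)
        exact h this.le
      rw [hsum, if_neg h, if_neg h]
  by_cases hkj : k = j
  · simp only [shiftedFactor, hkj, if_true] at key ⊢
    rw [key]
  · simp only [shiftedFactor, key, hkj, if_false]
    congr 1
    simp [Equiv.swap_apply_of_ne_of_ne hkj hk]

/-- Closedness of `u p` says exactly that `u p y a - u p (y + e b) a` is symmetric in the directions
`a` and `b`. -/
lemma shiftedFactor_sub_swap {u : Fin m → G → Fin m → ℝ} (c : G → ℝ) {j p : Fin m} (hp : p ≠ j)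
    (hu : IsGridCocycle e (u p)) (x : G) (τ : Equiv.Perm (Fin m)) :
    shiftedFactor e u c j p x (τ * Equiv.swap j p) p -
        shiftedFactor e u c j (p + 1) x (τ * Equiv.swap j p) p =
      shiftedFactor e u c j p x τ p - shiftedFactor e u c j (p + 1) x τ p := by
  have hsum : ∑ i ∈ (Finset.Iio p).erase j, e ((τ * Equiv.swap j p) i) =
      ∑ i ∈ (Finset.Iio p).erase j, e (τ i) := by
    refine Finset.sum_congr rfl fun i hi => ?_
    have h₁ := Finset.ne_of_mem_erase hi
    have h₂ := (Finset.mem_Iio.1 (Finset.mem_of_mem_erase hi)).ne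
    simp [Equiv.swap_apply_of_ne_of_ne h₁ h₂]
  simp only [Equiv.Perm.mul_apply] at hsum
  simp only [shiftedFactor, hp, if_false, le_refl, if_true, Equiv.Perm.mul_apply,
    Equiv.swap_apply_left, Equiv.swap_apply_right, Nat.not_succ_le_self, add_zero, hsum]
  have := hu (x + ∑ i ∈ (Finset.Iio p).erase j, e (τ i)) (τ p) (τ j)
  linarith

lemma pathVertex_eq_of_ne {j k : Fin m} (hk : k ≠ j) (x : G) (τ : Equiv.Perm (Fin m)) :
    x + ∑ i ∈ (Finset.Iio k).erase j, e (τ i) + (if (j : ℕ) ≤ k then e (τ j) else 0) =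
      pathVertex e τ x k := by
  rw [pathVertex]
  by_cases h : (j : ℕ) ≤ k
  · have hj : j ∈ Finset.Iio k := Finset.mem_Iio.2 (lt_of_le_of_ne h hk.symm)
    rw [if_pos h, ← Finset.add_sum_erase _ _ hj]
    abel
  · have hj : j ∉ Finset.Iio k := fun hj => h (Finset.mem_Iio.1 hj : j < k).le
    rw [if_neg h, Finset.erase_eq_of_notMem hj, add_zero]

lemma prod_update_gridDiff (u : Fin m → G → Fin m → ℝ) (c : G → ℝ) (j : Fin m)
    (x : G) (τ : Equiv.Perm (Fin m)) :
    ∏ k, Function.update u j (gridDiff e c) k (pathVertex e τ x k) (τ k) =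
      ∏ k, shiftedFactor e u c j j x τ k - ∏ k, shiftedFactor e u c j (j + 1) x τ k := by
  rw [prod_shiftedFactor_sub, ← Finset.mul_prod_erase _ _ (Finset.mem_univ j)]
  congr 1
  · simp [shiftedFactor, gridDiff, pathVertex]
  · refine Finset.prod_congr rfl fun k hk => ?_
    have hk := Finset.ne_of_mem_erase hk
    simp only [shiftedFactor, hk, if_false, pathVertex_eq_of_ne hk, ne_eq, not_false_eq_true,
      Function.update_of_ne]

/-- The cup product with an exact cochain evaluates to zero. -/
lemma cupSum_update_gridDiff [Fintype G] {u : Fin m → G → Fin m → ℝ} {j : Fin m}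
    (hu : ∀ k ≠ j, IsGridCocycle e (u k)) (c : G → ℝ) :
    cupSum e (Function.update u j (gridDiff e c)) = 0 := by
  let Q (p : ℕ) (x : G) (τ : Equiv.Perm (Fin m)) : ℝ := ∏ k, shiftedFactor e u c j p x τ k
  let S (p : ℕ) : ℝ := ∑ x, ∑ τ : Equiv.Perm (Fin m), ((τ.sign : ℤ) : ℝ) * Q p x τ
  -- Moving the step `e (τ j)` past the `p`-th vertex changes nothing: the terms of `τ` and `τ *
  -- swap j p` cancel by sign.
  have hS (p : Fin m) (hp : p ≠ j) : S p - S (p + 1) = 0 := by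
    simp only [S, ← Finset.sum_sub_distrib, ← mul_sub]
    refine Finset.sum_eq_zero fun x _ => sum_sign_mul_eq_zero_of_swap hp fun τ => ?_
    simp only [Q, prod_shiftedFactor_sub]
    rw [shiftedFactor_sub_swap c hp (hu p hp)]
    congr 1
    exact Finset.prod_congr rfl fun k hk =>
      shiftedFactor_swap c hp (Finset.ne_of_mem_erase hk) x τ
  -- At `0` every vertex is shifted by `e (τ j)`, at `m` none is; translating `x` identifies the two
  -- sums.
  have hends : S 0 = S m := by
    simp only [S]
    rw [Finset.sum_comm, Finset.sum_comm (s := Finset.univ (α := G))]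
    refine Finset.sum_congr rfl fun τ _ => ?_
    rw [← Equiv.sum_comp (Equiv.addRight (e (τ j))) (fun x => ((τ.sign : ℤ) : ℝ) * Q m x τ)]
    refine Finset.sum_congr rfl fun x _ => ?_
    congr 1
    refine Finset.prod_congr rfl fun k _ => ?_
    simp only [shiftedFactor, Nat.zero_le, if_true, not_le.2 k.2, if_false, add_zero,
      Equiv.coe_addRight, add_right_comm]
  have htel : ∑ p : Fin m, (S p - S (p + 1)) = 0 := by
    rw [Fin.sum_univ_eq_sum_range (fun p => S p - S (p + 1)), Finset.sum_range_sub', hends,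
      sub_self]
  -- Only `S j - S (j + 1)` survives the telescoping, and this is the cup product with `gridDiff e
  -- c` in slot `j`.
  rw [Finset.sum_eq_single j (fun p _ hp => hS p hp) (by simp)] at htel
  rw [← htel]
  simp only [cupSum, S, Q, prod_update_gridDiff, mul_sub, Finset.sum_sub_distrib]

lemma cupSum_update_sub [Fintype G] (u : Fin m → G → Fin m → ℝ) (j : Fin m) (v w : G → Fin m → ℝ) :
    cupSum e (Function.update u j (v - w)) =
      cupSum e (Function.update u j v) - cupSum e (Function.update u j w) := by
  simp only [cupSum, ← Finset.sum_sub_distrib, ← mul_sub]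
  refine Finset.sum_congr rfl fun x _ => Finset.sum_congr rfl fun τ _ => ?_
  congr 1
  have hrest (a : G → Fin m → ℝ) :
      ∏ k, Function.update u j a k (pathVertex e τ x k) (τ k) =
      a (pathVertex e τ x j) (τ j) *
        ∏ k ∈ Finset.univ.erase j, u k (pathVertex e τ x k) (τ k) := by
    rw [← Finset.mul_prod_erase _ _ (Finset.mem_univ j), Function.update_self]
    congr 1
    exact Finset.prod_congr rfl fun k hk => by
      rw [Function.update_of_ne (Finset.ne_of_mem_erase hk)]
  simp only [hrest, Pi.sub_apply, sub_mul]

/-- The linear cochain dual to the `k`-th direction, scaled by `s`. -/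
def linearCochain (s : ℝ) (k : Fin m) (_ : G) (i : Fin m) : ℝ := if i = k then s else 0

lemma cupSum_linearCochain [Fintype G] (s : ℝ) :
    cupSum e (linearCochain (G := G) (m := m) s) = Fintype.card G * s ^ m := by
  have h (τ : Equiv.Perm (Fin m)) (hτ : τ ≠ 1) :
      ∏ k, (if τ k = k then s else 0) = 0 := by
    obtain ⟨k, hk⟩ : ∃ k, τ k ≠ k := by
      by_contra! h
      exact hτ (Equiv.ext h)
    exact Finset.prod_eq_zero (Finset.mem_univ k) (if_neg hk)
  simp only [cupSum, linearCochain]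
  rw [Finset.sum_congr rfl fun x _ => Finset.sum_eq_single (1 : Equiv.Perm (Fin m))
    (fun τ _ hτ => by rw [h τ hτ, mul_zero]) (by simp)]
  simp

lemma isGridCocycle_linearCochain_sub (s : ℝ) (k : Fin m) (c : G → ℝ) :
    IsGridCocycle e (linearCochain s k - gridDiff e c) := by
  intro x i j
  simp only [linearCochain, gridDiff, Pi.sub_apply, add_right_comm x (e i) (e j)]
  ring

lemma cupSum_linearCochain_sub [Fintype G] (s : ℝ) (c : Fin m → G → ℝ) :
    cupSum e (fun k => linearCochain s k - gridDiff e (c k)) = Fintype.card G * s ^ m := by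
  -- The exact corrections are introduced one slot at a time; the other slots stay closed
  -- throughout.
  have h (T : Finset (Fin m)) :
      cupSum e (fun k => linearCochain s k - gridDiff e (if k ∈ T then c k else 0)) =
        Fintype.card G * s ^ m := by
    induction T using Finset.induction with
    | empty =>
      have : gridDiff e (0 : G → ℝ) = 0 := by ext; simp [gridDiff]
      simpa [this] using cupSum_linearCochain (e := e) s
    | insert j T hj ih =>
      rw [← ih]
      set u : Fin m → G → Fin m → ℝ :=
        fun k => linearCochain s k - gridDiff e (if k ∈ T then c k else 0) with hu
      have h₁ : (fun k => linearCochain s k - gridDiff e (if k ∈ insert j T then c k else 0)) =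
          Function.update u j (linearCochain s j - gridDiff e (c j)) := by
        ext1 k
        by_cases hk : k = j
        · subst hk; simp
        · simp [hk, hu]
      have h₂ : Function.update u j (linearCochain s j) = u := by
        rw [Function.update_eq_self_iff]
        have : gridDiff e (0 : G → ℝ) = 0 := by ext; simp [gridDiff]
        simp [hu, hj, this]
      rw [h₁, cupSum_update_sub, h₂, cupSum_update_gridDiff, sub_zero]
      exact fun k _ => isGridCocycle_linearCochain_sub s k _
  simpa using h Finset.univ

variable (e) in
/-- For any functions `c k` on the grid there is a monotone lattice path along which no `c k` has
at its `k`-th step the increment of the `k`-th linear coordinate. -/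
theorem exists_forall_gridDiff_ne [Fintype G] {s : ℝ} (hs : s ≠ 0) (c : Fin m → G → ℝ) :
    ∃ (x : G) (τ : Equiv.Perm (Fin m)), ∀ k,
      c k (pathVertex e τ x k + e (τ k)) - c k (pathVertex e τ x k) ≠ if τ k = k then s else 0 := by
  by_contra! h
  have h0 : cupSum e (fun k => linearCochain s k - gridDiff e (c k)) = 0 := by
    refine Finset.sum_eq_zero fun x _ => Finset.sum_eq_zero fun τ _ => ?_
    obtain ⟨k, hk⟩ := h x τ
    rw [Finset.prod_eq_zero (Finset.mem_univ k), mul_zero]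
    simp [linearCochain, gridDiff, hk]
  rw [cupSum_linearCochain_sub] at h0
  have : (Fintype.card G : ℝ) ≠ 0 := by exact_mod_cast Fintype.card_ne_zero
  exact mul_ne_zero this (pow_ne_zero _ hs) h0

end Grid

/-! ### From the grid to open covers of the torus -/

section TorusCover

variable {m : ℕ}

/-- Rotation of the torus by the angle `t` in the `i`-th coordinate. -/
noncomputable def rotate (i : Fin m) (t : ℝ) (z : Torus m) : Torus m :=
  z * Pi.mulSingle i (Circle.exp t)

lemma dist_mul_circleExp_le (z : Circle) (t : ℝ) : dist (z * Circle.exp t) z ≤ |t| := by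
  have h := Real.norm_exp_I_mul_ofReal_sub_one_le (x := t)
  have hz : dist (z * Circle.exp t) z = ‖(z : ℂ) * (Complex.exp (Complex.I * t) - 1)‖ := by
    change dist ((z * Circle.exp t : Circle) : ℂ) (z : ℂ) = _
    rw [dist_eq_norm, Circle.coe_mul, Circle.coe_exp, mul_sub, mul_one, mul_comm (t : ℂ)]
  rwa [hz, norm_mul, Circle.norm_coe, one_mul]

/-- The torus `Tᵐ` has no open cover `V` by `m` sets such that on `V k` the `k`-th angle
coordinate admits a primitive. -/
theorem not_exists_angle_primitive (V : Fin m → Set (Torus m)) (hV : ∀ k, IsOpen (V k))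
    (hcov : ⋃ k, V k = Set.univ) (h : Fin m → Torus m → ℝ)
    (hh : ∀ k i z s, (∀ t ∈ Set.Icc (0 : ℝ) s, rotate i t z ∈ V k) → 0 ≤ s →
      h k (rotate i s z) - h k z = if i = k then s else 0) : False := by
  obtain ⟨δ, hδ, hball⟩ := lebesgue_number_lemma_of_metric (isCompact_univ (X := Torus m))
    hV hcov.ge
  obtain ⟨N, hN⟩ := exists_nat_gt (2 * Real.pi / δ)
  have hN0 : 0 < (N : ℝ) := lt_trans (by positivity) hN
  have : NeZero N := ⟨by rintro rfl; simp at hN0⟩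
  -- The mesh `s` is below the Lebesgue number, so a whole lattice path from `P x` stays in one `V
  -- k`.
  set s : ℝ := 2 * Real.pi / N with hs
  have hs0 : 0 < s := by positivity
  have hsδ : s < δ := by
    rw [div_lt_iff₀ hδ] at hN
    rw [hs, div_lt_iff₀ hN0]
    linarith
  let P (x : Fin m → ZMod N) : Torus m := fun k => ZMod.toCircle (x k)
  let e (i : Fin m) : Fin m → ZMod N := Pi.single i 1
  have hone : ZMod.toCircle (1 : ZMod N) = Circle.exp s := by
    ext
    have := ZMod.toCircle_intCast (N := N) 1
    simp only [Int.cast_one, mul_one] at this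
    rw [this, Circle.coe_exp, hs]
    push_cast
    ring_nf
  have hstep (x : Fin m → ZMod N) (i : Fin m) : P (x + e i) = rotate i s (P x) := by
    ext k
    by_cases hk : k = i
    · subst hk
      simp [P, e, rotate, AddChar.map_add_eq_mul, hone]
    · simp [P, e, rotate, hk]
  obtain ⟨x, τ, hx⟩ := exists_forall_gridDiff_ne e hs0.ne' (fun k x => h k (P x))
  obtain ⟨k, hk⟩ := hball (P x) (Set.mem_univ _)
  refine hx k ?_
  rw [hstep, hh k (τ k) _ s (fun t ht => hk ?_) hs0.le]
  -- A path uses each direction once, so no coordinate moves by more than `s`; the sup metric then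
  -- gives the bound.
  have hv : pathVertex e τ x k = fun i => x i + if τ.symm i < k then 1 else 0 := by
    ext i
    simp only [pathVertex, e, Pi.add_apply, Finset.sum_apply, Pi.single_apply]
    congr 1
    simp only [← Equiv.symm_apply_eq, Finset.sum_ite_eq, Finset.mem_Iio]
  rw [Metric.mem_ball, dist_pi_lt_iff hδ]
  intro i
  rw [hv]
  by_cases hi : i = τ k
  · subst hi
    simp only [rotate, P, Equiv.symm_apply_apply, lt_irrefl, if_false, add_zero, Pi.mul_apply,
      Pi.mulSingle_eq_same]
    refine (dist_mul_circleExp_le _ _).trans_lt (lt_of_le_of_lt ?_ hsδ)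
    rw [abs_of_nonneg ht.1]
    exact ht.2
  · simp only [rotate, P, Pi.mul_apply, Pi.mulSingle_eq_of_ne hi, mul_one]
    split_ifs
    · rw [AddChar.map_add_eq_mul, hone]
      refine (dist_mul_circleExp_le _ _).trans_lt (lt_of_le_of_lt ?_ hsδ)
      rw [abs_of_pos hs0]
    · simpa using hδ

end TorusCover

open Simplicial

/-! ### Winding of singular simplices in the circle -/

section Winding

/-- A map from a topological simplex to the circle lifts to the line. -/
lemma exists_lift_stdSimplex {n : ℕ} (q : C(stdSimplex ℝ (Fin (n + 1)), Circle)) :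
    ∃ θ : C(stdSimplex ℝ (Fin (n + 1)), ℝ), ∀ a, Circle.exp (θ a) = q a := by
  let v : stdSimplex ℝ (Fin (n + 1)) := stdSimplex.vertex 0
  -- The straight-line contraction to a vertex makes `q` the end of a homotopy from a constant map,
  -- which lifts through `Circle.exp`.
  let seg : I × stdSimplex ℝ (Fin (n + 1)) → stdSimplex ℝ (Fin (n + 1)) := fun p =>
    ⟨(1 - (p.1 : ℝ)) • (v : Fin (n + 1) → ℝ) + (p.1 : ℝ) • (p.2 : Fin (n + 1) → ℝ),
      convex_stdSimplex ℝ _ v.2 p.2.2 (sub_nonneg.2 p.1.2.2) p.1.2.1 (by ring)⟩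
  have hseg : Continuous seg := by
    refine Continuous.subtype_mk ?_ _
    fun_prop
  obtain ⟨t₀, ht₀⟩ := Circle.exp_surjective (q v)
  let H : C(I × stdSimplex ℝ (Fin (n + 1)), Circle) := q.comp ⟨seg, hseg⟩
  have H0 : ∀ a, H (0, a) = Circle.exp (ContinuousMap.const _ t₀ a) := fun a => by
    have : seg (0, a) = v := Subtype.ext (by simp [seg]; rfl)
    simp [H, this, ht₀]
  let L := Circle.isCoveringMap_exp.liftHomotopy H (ContinuousMap.const _ t₀) H0
  refine ⟨L.comp ⟨fun a => (1, a), by fun_prop⟩, fun a => ?_⟩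
  have h := congrFun (Circle.isCoveringMap_exp.liftHomotopy_lifts H _ H0) (1, a)
  have h1 : seg (1, a) = a := Subtype.ext (by simp [seg]; rfl)
  exact h.trans (congrArg q h1)

lemma lift_sub_lift_eq {A : Type*} [TopologicalSpace A] [PreconnectedSpace A] {θ θ' : A → ℝ}
    (hθ : Continuous θ) (hθ' : Continuous θ')
    (h : ∀ a, Circle.exp (θ a) = Circle.exp (θ' a)) (a b : A) :
    θ b - θ a = θ' b - θ' a := by
  have := Circle.isCoveringMap_exp.const_of_comp (g := fun a => θ a - θ' a) (hθ.sub hθ')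
    (fun a a' => by simp [h]) a b
  linarith

/-- The total change of angle along a singular edge in the circle. -/
noncomputable def winding (q : C(stdSimplex ℝ (Fin 2), Circle)) : ℝ :=
  (exists_lift_stdSimplex q).choose (stdSimplex.vertex 1) -
    (exists_lift_stdSimplex q).choose (stdSimplex.vertex 0)

lemma winding_eq {q : C(stdSimplex ℝ (Fin 2), Circle)} {θ : stdSimplex ℝ (Fin 2) → ℝ}
    (hθ : Continuous θ) (h : ∀ a, Circle.exp (θ a) = q a) :
    winding q = θ (stdSimplex.vertex 1) - θ (stdSimplex.vertex 0) :=
  lift_sub_lift_eq (ContinuousMap.continuous _) hθ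
    (fun a => ((exists_lift_stdSimplex q).choose_spec a).trans (h a).symm) _ _

/-- The winding number around the boundary of a singular triangle vanishes. -/
lemma winding_boundary (q : C(stdSimplex ℝ (Fin 3), Circle)) :
    winding (q.comp ⟨_, stdSimplex.continuous_map (Fin.succAbove 0)⟩) -
      winding (q.comp ⟨_, stdSimplex.continuous_map (Fin.succAbove 1)⟩) +
      winding (q.comp ⟨_, stdSimplex.continuous_map (Fin.succAbove 2)⟩) = 0 := by
  obtain ⟨θ, hθ⟩ := exists_lift_stdSimplex q
  have h (i : Fin 3) : winding (q.comp ⟨_, stdSimplex.continuous_map i.succAbove⟩) =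
      θ (stdSimplex.vertex (i.succAbove 1)) - θ (stdSimplex.vertex (i.succAbove 0)) := by
    rw [winding_eq (θ := fun a => θ (stdSimplex.map i.succAbove a))
      (θ.continuous.comp (stdSimplex.continuous_map _)) (fun a => hθ _)]
    simp
  rw [h, h, h]
  have h₁ : (1 : Fin 3).succAbove 0 = 0 := rfl
  have h₂ : (1 : Fin 3).succAbove 1 = 2 := rfl
  have h₃ : (2 : Fin 3).succAbove 0 = 0 := rfl
  have h₄ : (2 : Fin 3).succAbove 1 = 1 := rfl
  have h₅ : (0 : Fin 3).succAbove 0 = 1 := rfl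
  have h₆ : (0 : Fin 3).succAbove 1 = 2 := rfl
  rw [h₁, h₂, h₃, h₄, h₅, h₆]
  ring

end Winding

/-! ### Primitives of the angle from vanishing on singular `H₁` -/

section Cochain

/-- The coefficient module `ℤ`. -/
abbrev coeffZ : ModuleCat.{u} ℤ := ModuleCat.of ℤ (ULift.{u} ℤ)

/-- The target of real-valued cochains. -/
abbrev coeffR : ModuleCat.{u} ℤ := ModuleCat.of ℤ (ULift.{u} ℝ)

/-- The morphism `ℤ ⟶ ℝ` with value `a` at `1`. -/
noncomputable def scaleHom : ℝ →+ (coeffZ.{u} ⟶ coeffR.{u}) where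
  toFun a := ModuleCat.ofHom
    (ULift.moduleEquiv.symm.toLinearMap ∘ₗ LinearMap.toSpanSingleton ℤ ℝ a ∘ₗ
      ULift.moduleEquiv.toLinearMap)
  map_zero' := by ext; simp
  map_add' a b := by ext; simp

lemma scaleHom_apply_one (a : ℝ) : (scaleHom.{u} a).hom (ULift.up 1) = ULift.up a := by
  simp [scaleHom]

/-- The circle, as a topological space in an arbitrary universe. -/
noncomputable abbrev circleTop : TopCat.{u} := TopCat.of (ULift.{u} Circle)

/-- The singular simplex in the circle, as a map to `Circle`. -/
noncomputable def circleSimplex {n : ℕ} (s : TopCat.toSSet.obj circleTop.{u} _⦋n⦌) :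
    C(stdSimplex ℝ (Fin (n + 1)), Circle) :=
  (⟨ULift.down, continuous_uliftDown⟩ : C(ULift.{u} Circle, Circle)).comp
    (circleTop.toSSetObjEquiv (.op ⦋n⦌) s)

/-- The singular chain complex of a space with integer coefficients. -/
noncomputable abbrev chains (V : TopCat.{u}) : ChainComplex (ModuleCat.{u} ℤ) ℕ :=
  (TopCat.toSSet.obj V).chainComplex coeffZ.{u}

/-- The angular cochain on the circle. -/
noncomputable def windingCochain : (chains circleTop.{u}).X 1 ⟶ coeffR.{u} :=
  Limits.Sigma.desc (fun s => scaleHom (winding (circleSimplex s)))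

lemma ι_windingCochain (s : TopCat.toSSet.obj circleTop.{u} _⦋1⦌) :
    (TopCat.toSSet.obj circleTop).ιChainComplex s ≫ windingCochain =
      scaleHom (winding (circleSimplex s)) :=
  Limits.Sigma.ι_desc _ _

lemma d_windingCochain : (chains circleTop.{u}).d 2 1 ≫ windingCochain = 0 := by
  refine SSet.chainComplex_hom_ext fun s => ?_
  rw [SSet.ιChainComplex_d_assoc, Limits.comp_zero, Fin.sum_univ_three]
  simp only [Preadditive.add_comp, Linear.smul_comp, ι_windingCochain]
  have h := congrArg scaleHom.{u} (winding_boundary (circleSimplex s))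
  rw [map_zero, map_add, map_sub] at h
  rw [← h]
  simp [sub_eq_add_neg]
  rfl

lemma injective_coeffR : Injective coeffR.{u} := by
  have : Module.Injective ℤ (ULift.{u} ℝ) :=
    ((Module.Baer.of_divisible ℝ).of_equiv ULift.moduleEquiv.symm).injective
  exact Module.injective_object_of_injective_module ℤ (ULift.{u} ℝ)

/-- A real cochain on the `1`-chains that vanishes on cycles is a coboundary. -/
lemma exists_d_comp_eq_of_iCycles_comp_eq_zero (K : ChainComplex (ModuleCat.{u} ℤ) ℕ)
    (φ : K.X 1 ⟶ coeffR.{u}) (hφ : K.iCycles 1 ≫ φ = 0) :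
    ∃ h : K.X 0 ⟶ coeffR.{u}, K.d 1 0 ≫ h = φ := by
  -- Divisibility of `ℝ` lets a homomorphism defined on the boundaries extend to all `0`-chains.
  have := injective_coeffR.{u}
  have hS : (ShortComplex.mk (K.iCycles 1) (K.d 1 0) (by simp)).Exact :=
    ShortComplex.exact_of_f_is_kernel _ (K.cyclesIsKernel 1 0 (by simp))
  exact ⟨hS.descToInjective φ hφ, hS.comp_descToInjective φ hφ⟩

/-- If a map `p : V → S¹` is trivial on `H₁`, the angle of `p` has a primitive on `V`. -/
theorem exists_angle_primitive (V : TopCat.{u}) (p : V ⟶ circleTop.{u})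
    (hp : singularH1.map p = 0) :
    ∃ h : V → ℝ, ∀ (γ : C(I, V)) (θ : I → ℝ), Continuous θ →
      (∀ t, Circle.exp (θ t) = (p (γ t)).down) → h (γ 1) - h (γ 0) = θ 1 - θ 0 := by
  let F := SSet.chainComplexMap (TopCat.toSSet.map p) coeffZ.{u}
  have hp' : HomologicalComplex.homologyMap F 1 = 0 := hp
  -- The winding cochain is closed, so on cycles its pullback factors through `H₁(p) = 0`.
  have hcyc : (chains V).iCycles 1 ≫ F.f 1 ≫ windingCochain = 0 := by
    rw [← HomologicalComplex.cyclesMap_i_assoc,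
      ← (chains circleTop).p_descOpcycles windingCochain 2 (by simp) d_windingCochain,
      ← HomologicalComplex.homology_π_ι_assoc, ← HomologicalComplex.homologyπ_naturality_assoc,
      hp', Limits.zero_comp, Limits.comp_zero]
  obtain ⟨h, hh⟩ := exists_d_comp_eq_of_iCycles_comp_eq_zero _ _ hcyc
  let pt (v : V) : TopCat.toSSet.obj V _⦋0⦌ :=
    (V.toSSetObjEquiv (.op ⦋0⦌)).symm (ContinuousMap.const _ v)
  let ev (g : coeffZ.{u} ⟶ coeffR.{u}) : ℝ := (g.hom (ULift.up 1) : ULift.{u} ℝ).down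
  refine ⟨fun v => ev ((TopCat.toSSet.obj V).ιChainComplex (pt v) ≫ h), fun γ θ hθ hθγ => ?_⟩
  let s : TopCat.toSSet.obj V _⦋1⦌ := (V.toSSetObjEquiv (.op ⦋1⦌)).symm
    (γ.comp (stdSimplexHomeomorphUnitInterval : C(stdSimplex ℝ (Fin 2), I)))
  have hface (i : Fin 2) : (TopCat.toSSet.obj V).δ i s =
      pt (γ (stdSimplexHomeomorphUnitInterval (stdSimplex.vertex (i.succAbove 0)))) := by
    apply (V.toSSetObjEquiv (.op ⦋0⦌)).injective
    ext a
    have ha : a = stdSimplex.vertex (S := ℝ) (X := Fin 1) 0 := Subsingleton.elim _ _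
    subst ha
    change γ (stdSimplexHomeomorphUnitInterval (stdSimplex.map i.succAbove (stdSimplex.vertex 0)))
      = _
    rw [stdSimplex.map_vertex]
    rfl
  have hw : winding (circleSimplex ((TopCat.toSSet.map p).app _ s)) = θ 1 - θ 0 := by
    rw [winding_eq (θ := fun a => θ (stdSimplexHomeomorphUnitInterval a)) (by fun_prop)
      (fun a => hθγ _)]
    simp
  have hs : (TopCat.toSSet.obj V).ιChainComplex (pt (γ 1)) ≫ h -
      (TopCat.toSSet.obj V).ιChainComplex (pt (γ 0)) ≫ h = scaleHom (θ 1 - θ 0) := by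
    rw [← hw, ← ι_windingCochain, ← SSet.ι_chainComplexMap_f_assoc, ← hh,
      SSet.ιChainComplex_d_assoc, Fin.sum_univ_two]
    simp [hface, sub_eq_add_neg]
  exact (congrArg ev hs).trans (congrArg ULift.down (scaleHom_apply_one _))

end Cochain

/-! ### Pulling back covers of `X` and `Xʳ` -/

section Covers

/-- A continuous map to a space in `Type`, as a morphism of `TopCat` to its universe lift. -/
def upHom {A : Type} [TopologicalSpace A] {W : Type u} [TopologicalSpace W] (p : C(W, A)) :
    TopCat.of W ⟶ TopCat.of (ULift.{u} A) :=
  TopCat.ofHom ⟨fun w => ULift.up (p w), by fun_prop⟩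

/-- The `j`-th coordinate on a subset of the torus, lifted to the universe `u`. -/
def coordOn {m : ℕ} (V : Set (Torus m)) (j : Fin m) : C(ULift.{u} V, Circle) :=
  ⟨fun z => (z.down : Torus m) j,
    (continuous_apply j).comp (continuous_subtype_val.comp continuous_uliftDown)⟩

/-- The torus `Tᵐ` is not covered by `m` or fewer open sets on which all coordinates are trivial
on `H₁`. -/
theorem not_cover_of_coordOn_eq_zero {m k : ℕ} (hkm : k < m) (U : Fin (k + 1) → Set (Torus m))
    (hU : ∀ i, IsOpen (U i)) (hcov : ⋃ i, U i = Set.univ)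
    (h0 : ∀ i j, singularH1.{u}.map (upHom (coordOn (U i) j)) = 0) : False := by
  classical
  -- Repeating the last set pads the cover to exactly `m` sets, one per coordinate.
  let a : Fin m → Fin (k + 1) := fun j => ⟨min j k, by omega⟩
  have ha : Function.Surjective a := fun i =>
    ⟨⟨i, by omega⟩, Fin.ext (min_eq_left (Nat.lt_succ_iff.1 i.2))⟩
  choose h hh using fun i j => exists_angle_primitive _ _ (h0 i j)
  refine not_exists_angle_primitive (fun j => U (a j)) (fun j => hU _)
    ((ha.iUnion_comp U).trans hcov)
    -- The value `0` off `U (a j)` is immaterial: only rotation arcs inside the set are tested.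
    (fun j z => if hz : z ∈ U (a j) then h (a j) j ⟨⟨z, hz⟩⟩ else 0) fun j i z s hs hs0 => ?_
  have hI (t : I) : rotate i (s * t) z ∈ U (a j) :=
    hs _ ⟨mul_nonneg hs0 t.2.1, mul_le_of_le_one_right hs0 t.2.2⟩
  have hcont : Continuous fun t : I => rotate i (s * t) z := by
    unfold rotate
    refine continuous_const.mul ((continuous_mulSingle i).comp ?_)
    exact Circle.exp.continuous.comp (by fun_prop)
  let γ : C(I, ULift.{u} (U (a j))) :=
    ⟨fun t => ⟨⟨rotate i (s * t) z, hI t⟩⟩, by fun_prop⟩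
  obtain ⟨t₀, ht₀⟩ := Circle.exp_surjective (z j)
  have key := hh (a j) j γ (fun t => t₀ + if i = j then s * t else 0)
    (by split_ifs <;> fun_prop) (fun t => by
      change _ = rotate i (s * t) z j
      by_cases hij : i = j
      · subst hij
        simp [rotate, ht₀]
      · simp [rotate, hij, Ne.symm hij, ht₀])
  have h1 : rotate i s z ∈ U (a j) := by simpa using hI 1
  have hz : z ∈ U (a j) := by simpa [rotate] using hI 0
  have e1 : γ 1 = ⟨⟨rotate i s z, h1⟩⟩ := by simp [γ]
  have e0 : γ 0 = ⟨⟨z, hz⟩⟩ := by simp [γ, rotate]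
  rw [e1, e0] at key
  rw [dif_pos h1, dif_pos hz, key]
  simp

lemma singularH1_map_eq_of_homotopic {W X : Type u} [TopologicalSpace W] [TopologicalSpace X]
    {a b : C(W, X)} (h : a.Homotopic b) :
    singularH1.map (TopCat.ofHom a) = singularH1.map (TopCat.ofHom b) :=
  TopCat.Homotopy.congr_homologyMap_singularChainComplexFunctor
    (f := TopCat.ofHom a) (g := TopCat.ofHom b) h.some _ 1

lemma singularH1_map_eq_zero_of_nullhomotopic {W X : Type u} [TopologicalSpace W]
    [TopologicalSpace X] {a : C(W, X)} (h : a.Nullhomotopic) :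
    singularH1.map (TopCat.ofHom a) = 0 := by
  obtain ⟨x, hx⟩ := h
  rw [singularH1_map_eq_of_homotopic hx]
  have hfac : TopCat.ofHom (ContinuousMap.const W x) =
      TopCat.ofHom (ContinuousMap.const W PUnit.unit) ≫
        TopCat.ofHom (ContinuousMap.const PUnit.{u + 1} x) := rfl
  have hzero : Limits.IsZero (singularH1.obj (TopCat.of PUnit.{u + 1})) :=
    AlgebraicTopology.isZero_singularHomologyFunctor_of_totallyDisconnectedSpace _ _ _ _
      one_ne_zero
  rw [hfac, Functor.map_comp, hzero.eq_zero_of_tgt (singularH1.map _), Limits.zero_comp]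

variable {X : Type u} [TopologicalSpace X] {n : ℕ}

lemma torusH1_upHom_apply {W : Type u} [TopologicalSpace W] (f : C(Torus n, X))
    (p : C(W, Torus n)) (z : singularH1.obj (TopCat.of W)) :
    torusH1 f ((singularH1.map (upHom p)).hom z) =
      (singularH1.map (TopCat.ofHom (f.comp p))).hom z := by
  have : TopCat.ofHom (f.comp p) = upHom p ≫ TopCat.ofHom
    (f.comp (⟨ULift.down, continuous_uliftDown⟩ : C(ULift.{u} (Torus n), Torus n))) := rfl
  rw [this, Functor.map_comp]
  rfl

lemma upHom_coord_eq_zero {W : Type u} [TopologicalSpace W] {p : C(W, Torus n)}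
    (hp : singularH1.map (upHom p) = 0) (j : Fin n) :
    singularH1.map (upHom ((⟨fun z => z j, continuous_apply j⟩ : C(Torus n, Circle)).comp p)) =
      0 := by
  have : upHom ((⟨fun z => z j, continuous_apply j⟩ : C(Torus n, Circle)).comp p) = upHom p ≫
      TopCat.ofHom ⟨fun z : ULift.{u} (Torus n) => ULift.up.{u} (z.down j), by fun_prop⟩ := rfl
  rw [this, Functor.map_comp, hp, Limits.zero_comp]

theorem le_lsCat_of_homologicallyDecomposable (f : C(Torus n, X))
    (hf : HomologicallyDecomposable f) : (n : ℕ∞) ≤ lsCat X := by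
  refine le_iInf₂ fun k ⟨U, hU, hcov, hnull⟩ => ?_
  by_contra! hk
  refine not_cover_of_coordOn_eq_zero.{u} (Nat.cast_lt.1 hk) (fun i => f ⁻¹' U i)
    (fun i => (hU i).preimage f.continuous) ?_ fun i j => ?_
  · rw [← Set.preimage_iUnion, hcov, Set.preimage_univ]
  let p : C(ULift.{u} (f ⁻¹' U i), Torus n) := ⟨fun z => z.down, by fun_prop⟩
  refine upHom_coord_eq_zero (p := p) ?_ j
  ext z
  apply hf
  rw [torusH1_upHom_apply]
  let q : C(ULift.{u} (f ⁻¹' U i), U i) := ⟨fun z => ⟨f z.down, z.down.2⟩, by fun_prop⟩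
  have hq : (f.comp p).Nullhomotopic := (hnull i).comp_left q
  rw [singularH1_map_eq_zero_of_nullhomotopic hq]
  simp

/-- The coordinate projections of a set `U ⊆ Xʳ` carrying a motion planner are homotopic. -/
lemma homotopic_of_pathEval_section {r : ℕ} {U : Set (Fin r → X)} (s : C(U, C(I, X)))
    (hs : ∀ p : U, pathEval r (s p) = p) (i j : Fin r) :
    (⟨fun p => (p : Fin r → X) i, (continuous_apply i).comp continuous_subtype_val⟩ :
      C(U, X)).Homotopic
      ⟨fun p => (p : Fin r → X) j, (continuous_apply j).comp continuous_subtype_val⟩ := by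
  have : PathConnectedSpace I := isPathConnected_iff_pathConnectedSpace.1
    ((convex_Icc (0 : ℝ) 1).isPathConnected ⟨0, by simp⟩)
  let γ := PathConnectedSpace.somePath (evalTime r i) (evalTime r j)
  refine ⟨⟨⟨fun q => s q.2 (γ q.1), by fun_prop⟩, fun p => ?_, fun p => ?_⟩⟩
  · simpa [pathEval] using congrFun (hs p) i
  · simpa [pathEval] using congrFun (hs p) j

theorem le_sequentialTC_of_homologicallyDisjoint (f g : C(Torus n, X))
    (hf : HomologicallyDecomposable f) (hg : HomologicallyDecomposable g)
    (hfg : HomologicallyDisjoint f g) (r : ℕ) (hr : 1 < r) :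
    ((r * n : ℕ) : ℕ∞) ≤ sequentialTC X r := by
  refine le_iInf₂ fun k ⟨U, hU, hcov, hsec⟩ => ?_
  by_contra! hk
  let i₀ : Fin r := ⟨0, by omega⟩
  -- A second factor, where `g` is used, is needed to bring the `f`-block into the intersection of
  -- the images.
  let i₁ : Fin r := ⟨1, hr⟩
  have h₁₀ : i₁ ≠ i₀ := by simp [i₀, i₁]
  let F (i : Fin r) : C(Torus n, X) := if i = i₀ then f else g
  let block (i : Fin r) : C(Torus (r * n), Torus n) :=
    ⟨fun z l => z (finProdFinEquiv (i, l)), by fun_prop⟩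
  let Φ : C(Torus (r * n), Fin r → X) := ⟨fun z i => F i (block i z), by fun_prop⟩
  refine not_cover_of_coordOn_eq_zero.{u} (Nat.cast_lt.1 hk) (fun i => Φ ⁻¹' U i)
    (fun i => (hU i).preimage Φ.continuous) ?_ fun a j => ?_
  · rw [← Set.preimage_iUnion, hcov, Set.preimage_univ]
  obtain ⟨s, hs⟩ := hsec a
  let p (i : Fin r) : C(ULift.{u} (Φ ⁻¹' U a), Torus n) :=
    ⟨fun z => block i z.down, by fun_prop⟩
  let q : C(ULift.{u} (Φ ⁻¹' U a), U a) := ⟨fun z => ⟨Φ z.down, z.down.2⟩, by fun_prop⟩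
  have hhom (i i' : Fin r) : ((F i).comp (p i)).Homotopic ((F i').comp (p i')) :=
    (homotopic_of_pathEval_section s hs i i').comp (.refl q)
  have heq (i : Fin r) (hi : i ≠ i₀) (z : singularH1.obj (TopCat.of (ULift.{u} (Φ ⁻¹' U a)))) :
      torusH1 f ((singularH1.map (upHom (p i₀))).hom z) =
        torusH1 g ((singularH1.map (upHom (p i))).hom z) := by
    have := singularH1_map_eq_of_homotopic (hhom i₀ i)
    simp only [F, if_true, hi, if_false] at this
    rw [torusH1_upHom_apply, torusH1_upHom_apply, this]
  have hzero (i : Fin r) (hi : i ≠ i₀)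
      (z : singularH1.obj (TopCat.of (ULift.{u} (Φ ⁻¹' U a)))) :
      -- By `heq` the class comes from both `f` and `g`, so disjointness kills it.
      torusH1 g ((singularH1.map (upHom (p i))).hom z) = 0 := by
    have : torusH1 g ((singularH1.map (upHom (p i))).hom z) ∈
        LinearMap.range (torusH1 f) ⊓ LinearMap.range (torusH1 g) :=
      ⟨⟨_, heq i hi z⟩, ⟨_, rfl⟩⟩
    rw [hfg] at this
    exact this
  have hp (i : Fin r) : singularH1.map (upHom (p i)) = 0 := by
    ext z
    by_cases hi : i = i₀
    · subst hi
      apply hf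
      rw [heq i₁ h₁₀, hzero i₁ h₁₀]
      simp
    · apply hg
      rw [hzero i hi]
      simp
  obtain ⟨⟨i, l⟩, rfl⟩ := finProdFinEquiv.surjective j
  exact upHom_coord_eq_zero (hp i) l

end Covers

end DecomposableTori

theorem proposition2p2 (X : Type*) [TopologicalSpace X] (n : ℕ) :
    ((∃ f : C(DecomposableTori.Torus n, X), DecomposableTori.HomologicallyDecomposable f) →
      (n : ℕ∞) ≤ DecomposableTori.lsCat X) ∧
    ((∃ f g : C(DecomposableTori.Torus n, X),
        DecomposableTori.HomologicallyDecomposable f ∧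
        DecomposableTori.HomologicallyDecomposable g ∧
        DecomposableTori.HomologicallyDisjoint f g) →
      ∀ r : ℕ, 1 < r → ((r * n : ℕ) : ℕ∞) ≤ DecomposableTori.sequentialTC X r) :=
  ⟨fun ⟨f, hf⟩ => DecomposableTori.le_lsCat_of_homologicallyDecomposable f hf,
    fun ⟨f, g, hf, hg, hfg⟩ r hr =>
      DecomposableTori.le_sequentialTC_of_homologicallyDisjoint f g hf hg hfg r hr⟩
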